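/- Let $d\ge 0$ be an integer, let $\mathcal P\subset\mathbb R^d$ be a centrally symmetric convex body (compact, convex, with nonempty interior, and $\mathcal P=-\mathcal P$), and let $\mathcal L\subset\mathbb R^d$ be a nonempty compact convex set of losses such that $\langle p,\ell\rangle\le 1$ for all $p\in\mathcal P$, $\ell\in\mathcal L$. Let $\mathrm{End}(\mathcal P)$ be the set of pairs $\phi=(M,a)\in\mathbb R^{d\times d}\times\mathbb R^d$ such that $\phi(p):=Mp+a\in\mathcal P$ for all $p\in\mathcal P$. For strategies $p_1,\dots,p_T\in\mathcal P$ and losses $\ell_1,\dots,\ell_T\in\mathcal L$ define $$\mathsf{LinearSwapReg}_T=\sum_{t=1}^T\langle \ell_t,p_t\rangle-\min_{\phi\in\mathrm{End}(\mathcal P)}\sum_{t=1}^T\langle \ell_t,\phi(p_t)\rangle .$$ A set is in John's position if the closed Euclidean unit ball centered at $0$ is contained in it and has maximum volume among all ellipsoids contained in it. On $\mathbb R^{d\times d}\times\mathbb R^d$ use the component-wise inner product $\langle (M,a),(N,c)\rangle=\sum_{i,j}M_{ij}N_{ij}+\sum_i a_ic_i$, and write $\ell\otimes p=\ell p^\top$.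 Let $b:\mathcal L\to\mathcal P$ be a best-response map, $b(\ell)\in\arg\min_{p\in\mathcal P}\langle \ell,p\rangle$ (ties broken arbitrarily). *Preconditioned response-based approachability* is the following online algorithm. Choose an invertible matrix $A$ such that $\mathcal P'=A\mathcal P$ is in John's position, put $\mathcal L'=A^{-\top}\mathcal L$, $b'(\ell')=A\,b(A^\top\ell')$ and $U_0=0\in\mathbb R^{d\times d}\times\mathbb R^d$. In each round $t=1,\dots,T$: 1. choose minimax strategies $p'_t\in\arg\min_{p'\in\mathcal P'}\max_{\ell'\in\mathcal L'}\langle U_{t-1},(\ell'\otimes p',\ell')\rangle$ and $\ell'^*_t\in\arg\max_{\ell'\in\mathcal L'}\min_{p'\in\mathcal P'}\langle U_{t-1},(\ell'\otimes p',\ell')\rangle$; 2. set $s'_t=(\ell'^*_t\otimes b'(\ell'^*_t),\ell'^*_t)$; 3. play $p_t=A^{-1}p'_t$ and observe a loss $\ell_t\in\mathcal L$; 4. set $\ell'_t=A^{-\top}\ell_t$, $\kappa'_t=(\ell'_t\otimes p'_t,\ell'_t)$ and $U_t=U_{t-1}+(\kappa'_t-s'_t)$. **Theorem.** The algorithm is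 well defined: a best-response map $b$ exists, a matrix $A$ as required exists, and for every such $A$ and every $U\in\mathbb R^{d\times d}\times\mathbb R^d$ minimax strategies as in step 1 (with $U$ in place of $U_{t-1}$) exist. Moreover, for every $T\ge 0$, every best-response map $b$, every admissible choice of $A$ and of the minimax strategies, and every sequence of losses $\ell_1,\dots,\ell_T\in\mathcal L$ (possibly chosen adaptively), the algorithm plays $p_1,\dots,p_T\in\mathcal P$ and guarantees $$\mathsf{LinearSwapReg}_T\le 8\,d\,\sqrt T .$$ -/

import Mathlib

open scoped BigOperators

noncomputable section

namespace LinSwap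

/-- Euclidean space `ℝ^d`. -/
abbrev Vec (d : ℕ) : Type := EuclideanSpace ℝ (Fin d)

/-- Pairs `(M, a)` of a `d × d` matrix and a vector, that is, `ℝ^{d × (d+1)}`. -/
abbrev MatVec (d : ℕ) : Type := Matrix (Fin d) (Fin d) ℝ × Vec d

/-- The action `x ↦ A x` of a matrix on `ℝ^d`. -/
def act {d : ℕ} (A : Matrix (Fin d) (Fin d) ℝ) (x : Vec d) : Vec d :=
  Matrix.toEuclideanLin A x

/-- The component-wise inner product on pairs `(M, a)`. -/
def pairing {d : ℕ} (U V : MatVec d) : ℝ :=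
  (∑ i, ∑ j, U.1 i j * V.1 i j) + ∑ i, U.2 i * V.2 i

/-- The pair `(ℓ ⊗ p, ℓ)`, where `ℓ ⊗ p = ℓ pᵀ`. -/
def tensorPair {d : ℕ} (l p : Vec d) : MatVec d :=
  (Matrix.of fun i j => l i * p j, l)

/-! Linear swap regret -/

/-- The affine endomorphisms `p ↦ M p + a` of `P`, represented by pairs `(M, a)`. -/
def affineEnd {d : ℕ} (P : Set (Vec d)) : Set (MatVec d) :=
  {φ | ∀ p ∈ P, act φ.1 p + φ.2 ∈ P}

/-- Linear swap regret (with the affine component) of the first `T` rounds: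
`∑ₜ ⟨ℓₜ, pₜ⟩ - min_{φ ∈ End(P)} ∑ₜ ⟨ℓₜ, φ(pₜ)⟩`.
For bounded `P` containing all `pₜ` the infimum is over a nonempty bounded set of reals. -/
def linearSwapReg {d : ℕ} (P : Set (Vec d)) (T : ℕ) (l p : ℕ → Vec d) : ℝ :=
  (∑ t ∈ Finset.range T, inner ℝ (l t) (p t)) -
    sInf ((fun φ : MatVec d =>
      ∑ t ∈ Finset.range T, inner ℝ (l t) (act φ.1 (p t) + φ.2)) '' affineEnd P)

/-! John's position -/

/-- A (nondegenerate, not necessarily centered) ellipsoid: the image of the closed Euclidean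
unit ball under an invertible affine map. -/
def IsEllipsoid {d : ℕ} (S : Set (Vec d)) : Prop :=
  ∃ (B : Matrix (Fin d) (Fin d) ℝ) (c : Vec d),
    IsUnit B.det ∧ S = (fun x => act B x + c) '' Metric.closedBall 0 1

/-- `K` is in John's position: the closed unit ball centered at `0` lies in `K` and has the
largest volume among all ellipsoids contained in `K`. -/
def InJohnPosition {d : ℕ} (K : Set (Vec d)) : Prop :=
  Metric.closedBall (0 : Vec d) 1 ⊆ K ∧
    ∀ S : Set (Vec d), IsEllipsoid S → S ⊆ K →
      MeasureTheory.volume S ≤ MeasureTheory.volume (Metric.closedBall (0 : Vec d) 1)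

/-- `A` is an invertible matrix that brings `P` into John's position. -/
def IsJohnPreconditioner {d : ℕ} (P : Set (Vec d)) (A : Matrix (Fin d) (Fin d) ℝ) : Prop :=
  IsUnit A.det ∧ InJohnPosition (act A '' P)

/-! The algorithm -/

/-- `b` is a best-response map: `b(ℓ) ∈ argmin_{p ∈ P} ⟨ℓ, p⟩` for `ℓ ∈ L`, with arbitrary
tie-breaking. -/
def IsBestResponse {d : ℕ} (P L : Set (Vec d)) (b : Vec d → Vec d) : Prop :=
  ∀ l ∈ L, b l ∈ P ∧ IsMinOn (fun p => (inner ℝ l p : ℝ)) P (b l)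

/-- `(p, ℓ)` is a pair of minimax strategies of the zero-sum game
`min_{p ∈ P} max_{ℓ ∈ L} ⟨U, (ℓ ⊗ p, ℓ)⟩`:
`p ∈ argmin_{p ∈ P} max_{ℓ ∈ L} ⟨U, (ℓ ⊗ p, ℓ)⟩` and
`ℓ ∈ argmax_{ℓ ∈ L} min_{p ∈ P} ⟨U, (ℓ ⊗ p, ℓ)⟩`. -/
def IsMinimaxPair {d : ℕ} (P L : Set (Vec d)) (U : MatVec d) (p l : Vec d) : Prop :=
  (p ∈ P ∧ IsMinOn (fun q => sSup ((fun m => pairing U (tensorPair m q)) '' L)) P p) ∧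
  (l ∈ L ∧ IsMaxOn (fun m => sInf ((fun q => pairing U (tensorPair m q)) '' P)) L l)

/-- The transformed strategy set `P' = A P`. -/
def preP {d : ℕ} (A : Matrix (Fin d) (Fin d) ℝ) (P : Set (Vec d)) : Set (Vec d) :=
  act A '' P

/-- The transformed loss set `L' = A^{-⊤} L`. -/
def preL {d : ℕ} (A : Matrix (Fin d) (Fin d) ℝ) (L : Set (Vec d)) : Set (Vec d) :=
  act (A⁻¹).transpose '' L

/-- The transformed best-response map `b'(ℓ') = A b(A^⊤ ℓ')`. -/
def preB {d : ℕ} (A : Matrix (Fin d) (Fin d) ℝ) (b : Vec d → Vec d) (l' : Vec d) : Vec d :=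
  act A (b (act A.transpose l'))

/-- The internal state `U` of the algorithm after `t` rounds: `U₀ = 0` and each round adds
`κ' - s'` with `κ' = (A^{-⊤}ℓ ⊗ p', A^{-⊤}ℓ)` and `s' = (ℓ'* ⊗ b'(ℓ'*), ℓ'*)`. Here `l` are the
observed losses and `p'`, `ls` the minimax strategies. Rounds are numbered from `0`. -/
def algState {d : ℕ} (A : Matrix (Fin d) (Fin d) ℝ) (b : Vec d → Vec d)
    (l p' ls : ℕ → Vec d) : ℕ → MatVec d
  | 0 => 0
  | t + 1 => algState A b l p' ls t +
      (tensorPair (act (A⁻¹).transpose (l t)) (p' t) - tensorPair (ls t) (preB A b (ls t)))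

/-- A `T`-round execution of preconditioned response-based approachability on `(P, L)` with
best-response map `b` against the losses `l`, in which the matrix `A` was chosen in the
preconditioning step, the minimax pair `(p' t, ls t)` was selected in round `t`, and the strategies
`p t` were played. -/
structure IsRun {d : ℕ} (P L : Set (Vec d)) (b : Vec d → Vec d)
    (A : Matrix (Fin d) (Fin d) ℝ) (T : ℕ) (l p' ls p : ℕ → Vec d) : Prop where
  precondition : IsJohnPreconditioner P A
  minimax : ∀ t < T, IsMinimaxPair (preP A P) (preL A L) (algState A b l p' ls t) (p' t) (ls t)
  play : ∀ t < T, p t = act A⁻¹ (p' t)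

end LinSwap

end

/-!
The idea is that John's position makes both factors of an approachability bound of order `√d`.

Write `P' = A P` for the strategy set in John's position. Every affine endomorphism `φ` of `P` is
conjugate to an endomorphism `(M, a)` of `P'`, and the regret against `φ` equals
`∑ₜ ⟨(1 - M, -a), κ'ₜ⟩`. Since `b'` is a best response, `⟨(1 - M, -a), s'ₜ⟩ ≤ 0`, so the regret is
at most `⟨(1 - M, -a), U_T⟩` (`sum_inner_sub_le_pairing_algState`), and the Cauchy–Schwarz
inequality leaves two norms to bound.

* By the minimax theorem a minimax pair is a saddle point, so `⟨U_{t-1}, κ'ₜ - s'ₜ⟩ ≤ 0` and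
  `‖U_T‖² ≤ 4 (d + 1) T` (`pairing_algState_self_le`). This uses `‖p'‖² ≤ d` on `P'`, and `‖ℓ'‖ ≤ 1`
  on the transformed losses, which are polar to `P'` and hence to the unit ball.
* `‖1 - M‖² + ‖a‖² ≤ 5 d` (`pairing_one_sub_self_le`). The point is that the Frobenius norm of `M`
  is at most `√d`, where the inclusion of `P'` in the ball of radius `√d` would only give `d`.

The facts about John's position all follow from `trace_le_of_inJohnPosition`: a positive
semidefinite `S` with `⟨u, S u⟩ ≤ 1` on the polar of `P'` has trace at most `d`. Taking `S = x xᵀ`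
with `x ∈ P'` gives `‖x‖² ≤ d`, and `S = M Mᵀ` gives the Frobenius bound, because `Mᵀ` maps the
polar into itself and the polar lies in the unit ball. The trace inequality is proved by comparing
the unit ball with the ellipsoids given by the square roots of `(1 - ε) 1 + ε S`, with no need for
contact points or the decomposition of the identity.
-/

namespace LinSwap

variable {d : ℕ}

/-! ### Matrices acting on Euclidean space -/

lemma act_apply (A : Matrix (Fin d) (Fin d) ℝ) (x : Vec d) (i : Fin d) :
    act A x i = ∑ j, A i j * x j := rfl

lemma act_mul (A B : Matrix (Fin d) (Fin d) ℝ) (x : Vec d) :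
    act (A * B) x = act A (act B x) := by
  simp [act, Matrix.toLpLin_apply, Matrix.mulVec_mulVec]

lemma act_one (x : Vec d) : act 1 x = x := by
  simp [act]

lemma act_vec_add (A : Matrix (Fin d) (Fin d) ℝ) (x y : Vec d) :
    act A (x + y) = act A x + act A y := map_add _ x y

lemma act_vec_smul (A : Matrix (Fin d) (Fin d) ℝ) (c : ℝ) (x : Vec d) :
    act A (c • x) = c • act A x := map_smul _ c x

lemma act_vec_neg (A : Matrix (Fin d) (Fin d) ℝ) (x : Vec d) :
    act A (-x) = -act A x := map_neg _ x

lemma act_add (A B : Matrix (Fin d) (Fin d) ℝ) (x : Vec d) :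
    act (A + B) x = act A x + act B x := by simp [act]

lemma act_sub (A B : Matrix (Fin d) (Fin d) ℝ) (x : Vec d) :
    act (A - B) x = act A x - act B x := by simp [act]

lemma act_smul (c : ℝ) (A : Matrix (Fin d) (Fin d) ℝ) (x : Vec d) :
    act (c • A) x = c • act A x := by simp [act]

lemma inner_eq_sum (x y : Vec d) : (inner ℝ x y : ℝ) = ∑ i, x i * y i := by
  simp [PiLp.inner_apply, mul_comm]

lemma inner_act_right (A : Matrix (Fin d) (Fin d) ℝ) (x y : Vec d) :
    (inner ℝ x (act A y) : ℝ) = inner ℝ (act A.transpose x) y := by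
  simp only [inner_eq_sum, act_apply, Finset.mul_sum, Finset.sum_mul, Matrix.transpose_apply]
  rw [Finset.sum_comm]
  exact Finset.sum_congr rfl fun _ _ => Finset.sum_congr rfl fun _ _ => by ring

lemma act_nonsing_inv_act {A : Matrix (Fin d) (Fin d) ℝ} (hA : IsUnit A.det) (x : Vec d) :
    act A⁻¹ (act A x) = x := by
  rw [← act_mul, Matrix.nonsing_inv_mul _ hA, act_one]

lemma act_act_nonsing_inv {A : Matrix (Fin d) (Fin d) ℝ} (hA : IsUnit A.det) (x : Vec d) :
    act A (act A⁻¹ x) = x := by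
  rw [← act_mul, Matrix.mul_nonsing_inv _ hA, act_one]

lemma continuous_act (A : Matrix (Fin d) (Fin d) ℝ) : Continuous (act A) :=
  LinearMap.continuous_of_finiteDimensional _

lemma continuous_act_left (x : Vec d) :
    Continuous fun A : Matrix (Fin d) (Fin d) ℝ => act A x := by
  simp only [act, Matrix.toLpLin_apply]
  fun_prop

lemma volume_image_act_add (B : Matrix (Fin d) (Fin d) ℝ) (c : Vec d) (s : Set (Vec d)) :
    MeasureTheory.volume ((fun x => act B x + c) '' s) =
      ENNReal.ofReal |B.det| * MeasureTheory.volume s := by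
  have h : (fun x => act B x + c) '' s = (fun x => x + c) '' (Matrix.toEuclideanLin B '' s) := by
    rw [Set.image_image]; rfl
  have hdet : LinearMap.det (Matrix.toEuclideanLin B) = B.det := by
    rw [Matrix.toEuclideanLin, Matrix.toLpLin_eq_toLin, LinearMap.det_toLin]
  rw [h, Set.image_add_right, MeasureTheory.measure_preimage_add_right,
    MeasureTheory.Measure.addHaar_image_linearMap, hdet]

/-! ### The trace inequality in John's position -/

lemma abs_det_le_one_of_inJohnPosition {K : Set (Vec d)} (hK : InJohnPosition K)
    {B : Matrix (Fin d) (Fin d) ℝ} (hB : ∀ x ∈ Metric.closedBall (0 : Vec d) 1, act B x ∈ K) :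
    |B.det| ≤ 1 := by
  by_cases hdet : IsUnit B.det
  · have h := hK.2 ((fun x => act B x + 0) '' Metric.closedBall 0 1) ⟨B, 0, hdet, rfl⟩
      (by rintro _ ⟨x, hx, rfl⟩; simpa using hB x hx)
    rw [volume_image_act_add] at h
    have h0 : MeasureTheory.volume (Metric.closedBall (0 : Vec d) 1) ≠ 0 :=
      (Metric.measure_closedBall_pos _ _ one_pos).ne'
    have htop : MeasureTheory.volume (Metric.closedBall (0 : Vec d) 1) ≠ ⊤ :=
      MeasureTheory.measure_closedBall_lt_top.ne
    rw [← ENNReal.le_div_iff_mul_le (Or.inl h0) (Or.inl htop), ENNReal.div_self h0 htop,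
      ENNReal.ofReal_le_one] at h
    exact h
  · have : B.det = 0 := by simpa using hdet
    simp [this]

/-- The bipolar theorem, with the polar taken as the set of functionals that are at most one. -/
lemma mem_of_forall_polar {K : Set (Vec d)} (hconv : Convex ℝ K) (hcl : IsClosed K)
    (hball : Metric.closedBall (0 : Vec d) 1 ⊆ K) {y : Vec d}
    (hy : ∀ u : Vec d, (∀ x ∈ K, (inner ℝ u x : ℝ) ≤ 1) → (inner ℝ u y : ℝ) ≤ 1) : y ∈ K := by
  by_contra hyK
  obtain ⟨f, s, hs, hsy⟩ := geometric_hahn_banach_closed_point hconv hcl hyK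
  have hs0 : 0 < s := by simpa using hs 0 (hball (by simp))
  set v : Vec d := (InnerProductSpace.toDual ℝ (Vec d)).symm f with hv
  have hf : ∀ x, f x = inner ℝ v x := fun x => by simp [hv]
  have h := hy (s⁻¹ • v) fun x hx => by
    rw [real_inner_smul_left, ← hf, inv_mul_le_iff₀ hs0, mul_one]
    exact (hs x hx).le
  rw [real_inner_smul_left, ← hf, inv_mul_le_iff₀ hs0, mul_one] at h
  exact absurd h (not_le.mpr hsy)

lemma norm_le_one_of_inner_le_one {K : Set (Vec d)}
    (hball : Metric.closedBall (0 : Vec d) 1 ⊆ K) {u : Vec d}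
    (hu : ∀ x ∈ K, (inner ℝ u x : ℝ) ≤ 1) : ‖u‖ ≤ 1 := by
  rcases eq_or_ne u 0 with rfl | h0
  · simp
  · have hn : ‖u‖ ≠ 0 := norm_ne_zero_iff.mpr h0
    have h := hu (‖u‖⁻¹ • u) (hball (by simp [norm_smul, hn]))
    rw [real_inner_smul_right, real_inner_self_eq_norm_sq] at h
    field_simp at h
    exact h

open scoped MatrixOrder in
lemma exists_eq_mul_transpose_of_posSemidef {S : Matrix (Fin d) (Fin d) ℝ} (hS : S.PosSemidef) :
    ∃ B : Matrix (Fin d) (Fin d) ℝ, S = B * B.transpose := by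
  obtain ⟨C, hC⟩ := CStarAlgebra.nonneg_iff_eq_star_mul_self.mp hS.nonneg
  exact ⟨C.transpose, by simpa [Matrix.star_eq_conjTranspose] using hC⟩

/-- The trace form of John's theorem: if a positive semidefinite quadratic form is at most one on
the polar of a closed convex set in John's position, then its trace is at most the dimension.
The matrices `(1 - ε) 1 + ε S` have the same property, so their square roots map the unit ball into
the set; by maximality of the ball their determinants are at most one, and the derivative of the
determinant at `ε = 0` is `tr S - d`. -/
theorem trace_le_of_inJohnPosition {K : Set (Vec d)} (hconv : Convex ℝ K) (hcl : IsClosed K)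
    (hK : InJohnPosition K) {S : Matrix (Fin d) (Fin d) ℝ} (hS : S.PosSemidef)
    (hpol : ∀ u : Vec d, (∀ x ∈ K, (inner ℝ u x : ℝ) ≤ 1) → (inner ℝ u (act S u) : ℝ) ≤ 1) :
    S.trace ≤ d := by
  have hdet : ∀ ε : ℝ, 0 < ε → ε ≤ 1 → (1 + ε • (S - 1)).det ≤ 1 := by
    intro ε hε hε1
    have hpsd : (1 + ε • (S - 1)).PosSemidef := by
      have : 1 + ε • (S - 1) = (1 - ε) • (1 : Matrix (Fin d) (Fin d) ℝ) + ε • S := by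
        module
      rw [this]
      exact (Matrix.PosSemidef.one.smul (by linarith)).add (hS.smul hε.le)
    obtain ⟨B, hB⟩ := exists_eq_mul_transpose_of_posSemidef hpsd
    have hB1 : |B.det| ≤ 1 := by
      refine abs_det_le_one_of_inJohnPosition hK fun x hx => ?_
      refine mem_of_forall_polar hconv hcl hK.1 fun u hu => ?_
      have hu1 := norm_le_one_of_inner_le_one hK.1 hu
      have hBu : ‖act B.transpose u‖ ^ 2 ≤ 1 := by
        have h1 : ‖act B.transpose u‖ ^ 2 =
            (1 - ε) * ‖u‖ ^ 2 + ε * inner ℝ u (act S u) := by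
          rw [← real_inner_self_eq_norm_sq, ← inner_act_right, ← act_mul, ← hB, act_add, act_one,
            act_smul, act_sub, act_one, inner_add_right, real_inner_smul_right, inner_sub_right,
            real_inner_self_eq_norm_sq]
          ring
        have h2 := hpol u hu
        have h3 : ‖u‖ ^ 2 ≤ 1 := pow_le_one₀ (norm_nonneg _) hu1
        rw [h1]
        nlinarith
      have hBu' : ‖act B.transpose u‖ ≤ 1 := by
        rwa [sq_le_one_iff₀ (norm_nonneg _)] at hBu
      have hx1 : ‖x‖ ≤ 1 := by simpa using hx
      rw [inner_act_right]
      exact (real_inner_le_norm _ _).trans (mul_le_one₀ hBu' (norm_nonneg _) hx1)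
    rw [hB, Matrix.det_mul, Matrix.det_transpose, ← abs_mul_abs_self]
    exact mul_le_one₀ hB1 (abs_nonneg _) hB1
  -- The expansion `det (1 + ε N) = 1 + ε tr N + O(ε²)` turns `hdet` into a bound on `tr (S - 1)`.
  have htr : (S - 1).trace ≤ 0 := by
    set N := S - 1
    set q : ℝ → ℝ := fun ε =>
      ((Matrix.det (1 + (Polynomial.X : Polynomial ℝ) • N.map Polynomial.C)).divX.divX).eval ε
    have hq : Continuous q := Polynomial.continuous _
    have hle : ∀ᶠ ε in nhdsWithin (0 : ℝ) (Set.Ioi 0), N.trace + q ε * ε ≤ 0 := by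
      filter_upwards [Ioc_mem_nhdsGT (zero_lt_one' ℝ)] with ε hε
      have h := hdet ε hε.1 hε.2
      rw [Matrix.det_one_add_smul] at h
      have h' : (N.trace + q ε * ε) * ε ≤ 0 := by
        simp only [q]; nlinarith
      exact nonpos_of_mul_nonpos_left h' hε.1
    have hlim : Filter.Tendsto (fun ε => N.trace + q ε * ε) (nhdsWithin (0 : ℝ) (Set.Ioi 0))
        (nhds (N.trace + q 0 * 0)) :=
      ((by fun_prop : Continuous fun ε => N.trace + q ε * ε).tendsto 0).mono_left
        nhdsWithin_le_nhds
    simpa using le_of_tendsto hlim hle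
  have : (S - 1).trace = S.trace - d := by simp [Matrix.trace_sub]
  linarith

lemma norm_sq_le_of_inJohnPosition {K : Set (Vec d)} (hconv : Convex ℝ K) (hcl : IsClosed K)
    (hsymm : ∀ x ∈ K, -x ∈ K) (hK : InJohnPosition K) {x : Vec d} (hx : x ∈ K) :
    ‖x‖ ^ 2 ≤ d := by
  have h := trace_le_of_inJohnPosition hconv hcl hK
    (S := Matrix.vecMulVec x (star (x : Fin d → ℝ)))
    (Matrix.posSemidef_vecMulVec_self_star _) fun u hu => by
      have h1 : (inner ℝ u x : ℝ) ≤ 1 := hu x hx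
      have h2 : -(inner ℝ u x : ℝ) ≤ 1 := by simpa using hu _ (hsymm x hx)
      have h3 : act (Matrix.vecMulVec x (star (x : Fin d → ℝ))) u = (inner ℝ u x : ℝ) • x := by
        ext i
        simp only [act_apply, Matrix.vecMulVec_apply, inner_eq_sum, PiLp.smul_apply, smul_eq_mul,
          Finset.sum_mul, star_trivial]
        exact Finset.sum_congr rfl fun _ _ => by ring
      rw [h3, real_inner_smul_right]
      nlinarith
  rw [← real_inner_self_eq_norm_sq, inner_eq_sum]
  simpa [Matrix.trace, Matrix.vecMulVec_apply] using h

/-- A linear endomorphism of a body in John's position has squared Frobenius norm at most `d`,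
because its adjoint maps the polar body into the unit ball. -/
lemma sum_sq_le_of_inJohnPosition {K : Set (Vec d)} (hconv : Convex ℝ K) (hcl : IsClosed K)
    (hK : InJohnPosition K) {M : Matrix (Fin d) (Fin d) ℝ} (hM : ∀ x ∈ K, act M x ∈ K) :
    ∑ i, ∑ j, M i j * M i j ≤ d := by
  have h := trace_le_of_inJohnPosition hconv hcl hK (S := M * M.transpose)
    (by simpa using Matrix.posSemidef_self_mul_conjTranspose M) fun u hu => by
      have h1 : ‖act M.transpose u‖ ≤ 1 := norm_le_one_of_inner_le_one hK.1 fun x hx => by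
        rw [← inner_act_right]
        exact hu _ (hM x hx)
      rw [act_mul, inner_act_right, real_inner_self_eq_norm_sq]
      exact pow_le_one₀ (norm_nonneg _) h1
  simpa [Matrix.trace, Matrix.mul_apply] using h

/-! ### Existence of a John preconditioner -/

lemma zero_mem_interior_of_symm {P : Set (Vec d)} (hconv : Convex ℝ P)
    (hint : (interior P).Nonempty) (hsymm : ∀ x ∈ P, -x ∈ P) : (0 : Vec d) ∈ interior P := by
  obtain ⟨x, hx⟩ := hint
  refine hconv.openSegment_interior_self_subset_interior hx (hsymm x (interior_subset hx)) ?_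
  exact ⟨1 / 2, 1 / 2, by norm_num, by norm_num, by norm_num, by module⟩

/-- The matrices that map the closed unit ball into a compact set form a compact set. -/
lemma isCompact_setOf_act_closedBall_subset {P : Set (Vec d)} (hP : IsCompact P) :
    IsCompact {B : Matrix (Fin d) (Fin d) ℝ |
      ∀ x ∈ Metric.closedBall (0 : Vec d) 1, act B x ∈ P} := by
  obtain ⟨R, hR⟩ := hP.isBounded.exists_norm_le
  have hbox : IsCompact {B : Matrix (Fin d) (Fin d) ℝ | ∀ i, B i ∈ {v : Fin d → ℝ |
      ∀ j, v j ∈ Set.Icc (-R) R}} :=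
    isCompact_pi_infinite fun _ => isCompact_pi_infinite fun _ => isCompact_Icc
  refine hbox.of_isClosed_subset ?_ fun B hB i j => ?_
  · simp only [Set.ofPred_forall]
    exact isClosed_iInter fun x => isClosed_iInter fun _ =>
      hP.isClosed.preimage (continuous_act_left x)
  · have h1 : act B (EuclideanSpace.single j 1) i = B i j := by simp [act_apply]
    have h2 := hR _ (hB (EuclideanSpace.single j 1) (by simp))
    rw [← h1, Set.mem_Icc, ← abs_le, ← Real.norm_eq_abs]
    exact (PiLp.norm_apply_le _ i).trans h2

/-- A symmetric convex set contains, with an ellipsoid, its translate centered at the origin. -/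
lemma act_mem_of_image_subset {K : Set (Vec d)} (hconv : Convex ℝ K) (hsymm : ∀ x ∈ K, -x ∈ K)
    {B : Matrix (Fin d) (Fin d) ℝ} {c : Vec d}
    (h : (fun x => act B x + c) '' Metric.closedBall 0 1 ⊆ K) {x : Vec d}
    (hx : x ∈ Metric.closedBall (0 : Vec d) 1) : act B x ∈ K := by
  have h1 : act B x + c ∈ K := h ⟨x, hx, rfl⟩
  have h2 : -(act B (-x) + c) ∈ K := hsymm _ (h ⟨-x, by simpa using hx, rfl⟩)
  rw [act_vec_neg] at h2
  have h3 := hconv h1 h2 (by norm_num : (0 : ℝ) ≤ 1 / 2) (by norm_num : (0 : ℝ) ≤ 1 / 2)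
    (by norm_num)
  convert h3 using 1
  module

/-- A matrix `B` of largest determinant among those that map the unit ball into `P` is invertible,
and its inverse brings `P` into John's position. -/
theorem exists_isJohnPreconditioner {P : Set (Vec d)} (hconv : Convex ℝ P) (hcomp : IsCompact P)
    (hint : (interior P).Nonempty) (hsymm : ∀ x ∈ P, -x ∈ P) :
    ∃ A : Matrix (Fin d) (Fin d) ℝ, IsJohnPreconditioner P A := by
  obtain ⟨r, hr, hrP⟩ := Metric.nhds_basis_closedBall.mem_iff.mp
    (mem_interior_iff_mem_nhds.mp (zero_mem_interior_of_symm hconv hint hsymm))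
  have hr1 : r • (1 : Matrix (Fin d) (Fin d) ℝ) ∈ {B : Matrix (Fin d) (Fin d) ℝ |
      ∀ x ∈ Metric.closedBall (0 : Vec d) 1, act B x ∈ P} := fun x hx => by
    rw [act_smul, act_one]
    refine hrP ?_
    rw [mem_closedBall_zero_iff] at hx ⊢
    rw [norm_smul, Real.norm_of_nonneg hr.le]
    exact mul_le_of_le_one_right hr.le hx
  obtain ⟨B, hB, hmax⟩ := (isCompact_setOf_act_closedBall_subset hcomp).exists_isMaxOn ⟨_, hr1⟩
    (f := fun B => |B.det|) (by fun_prop)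
  have hBpos : 0 < |B.det| := by
    refine lt_of_lt_of_le ?_ (hmax hr1)
    simp only [Matrix.det_smul, Matrix.det_one, mul_one]
    positivity
  have hBdet : IsUnit B.det := by simpa using hBpos
  have hcancel : ∀ y ∈ act B⁻¹ '' P, act B y ∈ P := by
    rintro _ ⟨p, hp, rfl⟩
    rwa [act_act_nonsing_inv hBdet]
  refine ⟨B⁻¹, Matrix.isUnit_nonsing_inv_det B hBdet,
    fun x hx => ⟨act B x, hB x hx, act_nonsing_inv_act hBdet x⟩, ?_⟩
  rintro S ⟨C, c, -, rfl⟩ hS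
  have hBC : ∀ x ∈ Metric.closedBall (0 : Vec d) 1, act (B * C) x ∈ P := fun x hx => by
    refine act_mem_of_image_subset (c := act B c) hconv hsymm ?_ hx
    rintro _ ⟨y, hy, rfl⟩
    simpa only [act_mul, act_vec_add] using hcancel _ (hS ⟨y, hy, rfl⟩)
  have h : |(B * C).det| ≤ |B.det| := hmax hBC
  rw [Matrix.det_mul, abs_mul] at h
  have hC : |C.det| ≤ 1 := le_of_mul_le_mul_left (by linarith) hBpos
  rw [volume_image_act_add]
  exact mul_le_of_le_one_left zero_le (ENNReal.ofReal_le_one.mpr hC)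

/-! ### The pairing -/

lemma pairing_tensorPair (U : MatVec d) (l p : Vec d) :
    pairing U (tensorPair l p) = inner ℝ l (act U.1 p + U.2) := by
  simp only [pairing, tensorPair, inner_eq_sum, act_apply, PiLp.add_apply, Matrix.of_apply,
    mul_add, Finset.sum_add_distrib, Finset.mul_sum]
  congr 1
  · exact Finset.sum_congr rfl fun _ _ => Finset.sum_congr rfl fun _ _ => by ring
  · exact Finset.sum_congr rfl fun _ _ => by ring

lemma pairing_add_right (U V W : MatVec d) : pairing U (V + W) = pairing U V + pairing U W := by
  simp only [pairing, Prod.fst_add, Prod.snd_add, Matrix.add_apply, PiLp.add_apply, mul_add,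
    Finset.sum_add_distrib]
  ring

lemma pairing_sub_right (U V W : MatVec d) : pairing U (V - W) = pairing U V - pairing U W := by
  simp only [pairing, Prod.fst_sub, Prod.snd_sub, Matrix.sub_apply, PiLp.sub_apply, mul_sub,
    Finset.sum_sub_distrib]
  ring

lemma pairing_comm (U V : MatVec d) : pairing U V = pairing V U := by
  simp only [pairing, mul_comm]

lemma pairing_self_nonneg (U : MatVec d) : 0 ≤ pairing U U :=
  add_nonneg (Finset.sum_nonneg fun _ _ => Finset.sum_nonneg fun _ _ => mul_self_nonneg _)
    (Finset.sum_nonneg fun _ _ => mul_self_nonneg _)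

lemma pairing_smul_right (c : ℝ) (U V : MatVec d) : pairing U (c • V) = c * pairing U V := by
  simp only [pairing, Prod.smul_fst, Prod.smul_snd, Matrix.smul_apply, PiLp.smul_apply,
    smul_eq_mul, mul_add, Finset.mul_sum, mul_left_comm]

lemma pairing_add_self (U V : MatVec d) :
    pairing (U + V) (U + V) = pairing U U + 2 * pairing U V + pairing V V := by
  rw [pairing_add_right, pairing_comm (U + V) U, pairing_comm (U + V) V, pairing_add_right,
    pairing_add_right, pairing_comm V U]
  ring

lemma pairing_sub_self_le (U V : MatVec d) :
    pairing (U - V) (U - V) ≤ 2 * pairing U U + 2 * pairing V V := by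
  have h := pairing_self_nonneg (U + V)
  rw [pairing_add_self] at h
  rw [pairing_sub_right, pairing_comm (U - V) U, pairing_comm (U - V) V, pairing_sub_right,
    pairing_sub_right, pairing_comm V U]
  linarith

/-- The Cauchy–Schwarz inequality for the component-wise inner product. -/
lemma sq_pairing_le (U V : MatVec d) : pairing U V ^ 2 ≤ pairing U U * pairing V V := by
  have h := discrim_le_zero (a := pairing V V) (b := 2 * pairing U V) (c := pairing U U)
    fun x => by
      have h := pairing_self_nonneg (U + x • V)
      rw [pairing_add_self, pairing_smul_right, pairing_smul_right, pairing_comm (x • V) V,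
        pairing_smul_right] at h
      linarith
  rw [discrim] at h
  linarith

lemma pairing_tensorPair_self (l p : Vec d) :
    pairing (tensorPair l p) (tensorPair l p) = ‖l‖ ^ 2 * (‖p‖ ^ 2 + 1) := by
  simp only [← real_inner_self_eq_norm_sq, inner_eq_sum, pairing, tensorPair, Matrix.of_apply,
    mul_add, mul_one, Finset.sum_mul_sum]
  congr 1
  exact Finset.sum_congr rfl fun _ _ => Finset.sum_congr rfl fun _ _ => by ring

/-! ### Minimax strategies -/

lemma continuous_pairing_tensorPair (U : MatVec d) :
    Continuous fun x : Vec d × Vec d => pairing U (tensorPair x.1 x.2) := by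
  simp only [pairing_tensorPair]
  exact continuous_fst.inner (((continuous_act U.1).comp continuous_snd).add continuous_const)

lemma exists_isSaddlePointOn_pairing {P L : Set (Vec d)} (hPconv : Convex ℝ P)
    (hPcomp : IsCompact P) (hPne : P.Nonempty) (hLconv : Convex ℝ L) (hLcomp : IsCompact L)
    (hLne : L.Nonempty) (U : MatVec d) :
    ∃ p ∈ P, ∃ l ∈ L, IsSaddlePointOn P L (fun q m => pairing U (tensorPair m q)) p l := by
  have hc := continuous_pairing_tensorPair U
  refine Sion.exists_isSaddlePointOn hPne hPconv hPcomp ?_ ?_ hLconv hLne hLcomp ?_ ?_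
  · exact fun m _ => (hc.comp (.prodMk_right m)).lowerSemicontinuous.lowerSemicontinuousOn _
  · refine fun m _ => ConvexOn.quasiconvexOn ⟨hPconv, fun x _ y _ a b _ _ hab => le_of_eq ?_⟩
    have hU : U.2 = a • U.2 + b • U.2 := by rw [← add_smul, hab, one_smul]
    simp only [pairing_tensorPair, act_vec_add, act_vec_smul, inner_add_right,
      real_inner_smul_right, smul_eq_mul]
    conv_lhs => rw [hU, inner_add_right, real_inner_smul_right, real_inner_smul_right]
    ring
  · exact fun q _ => (hc.comp (.prodMk_left q)).upperSemicontinuous.upperSemicontinuousOn _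
  · refine fun q _ => ConcaveOn.quasiconcaveOn ⟨hLconv, fun x _ y _ a b _ _ _ => le_of_eq ?_⟩
    simp only [pairing_tensorPair, inner_add_left, real_inner_smul_left, smul_eq_mul]

lemma pairing_le_sSup {L : Set (Vec d)} (hL : IsCompact L) (U : MatVec d) (p : Vec d) {m : Vec d}
    (hm : m ∈ L) :
    pairing U (tensorPair m p) ≤ sSup ((fun m => pairing U (tensorPair m p)) '' L) :=
  le_csSup (hL.bddAbove_image
    ((continuous_pairing_tensorPair U).comp (.prodMk_left p)).continuousOn) ⟨m, hm, rfl⟩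

lemma sInf_le_pairing {P : Set (Vec d)} (hP : IsCompact P) (U : MatVec d) (l : Vec d) {q : Vec d}
    (hq : q ∈ P) :
    sInf ((fun q => pairing U (tensorPair l q)) '' P) ≤ pairing U (tensorPair l q) :=
  csInf_le (hP.bddBelow_image
    ((continuous_pairing_tensorPair U).comp (.prodMk_right l)).continuousOn) ⟨q, hq, rfl⟩

/-- A saddle point is a minimax pair. -/
lemma exists_isMinimaxPair {P L : Set (Vec d)} (hPconv : Convex ℝ P)
    (hPcomp : IsCompact P) (hPne : P.Nonempty) (hLconv : Convex ℝ L) (hLcomp : IsCompact L)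
    (hLne : L.Nonempty) (U : MatVec d) : ∃ p l : Vec d, IsMinimaxPair P L U p l := by
  obtain ⟨p, hp, l, hl, h⟩ :=
    exists_isSaddlePointOn_pairing hPconv hPcomp hPne hLconv hLcomp hLne U
  refine ⟨p, l, ⟨hp, fun q hq => ?_⟩, hl, fun m hm => ?_⟩
  · rw [Set.mem_ofPred_eq]
    refine csSup_le (hLne.image _) ?_
    rintro _ ⟨m, hm, rfl⟩
    exact (h q hq m hm).trans (pairing_le_sSup hLcomp U q hl)
  · rw [Set.mem_ofPred_eq]
    refine le_csInf (hPne.image _) ?_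
    rintro _ ⟨q, hq, rfl⟩
    exact (sInf_le_pairing hPcomp U m hp).trans (h q hq m hm)

/-- Every minimax pair is a saddle point, by the minimax theorem. -/
lemma IsMinimaxPair.isSaddlePointOn {P L : Set (Vec d)} (hPconv : Convex ℝ P)
    (hPcomp : IsCompact P) (hLconv : Convex ℝ L) (hLcomp : IsCompact L) {U : MatVec d}
    {p l : Vec d} (h : IsMinimaxPair P L U p l) :
    IsSaddlePointOn P L (fun q m => pairing U (tensorPair m q)) p l := by
  obtain ⟨⟨hp, hpmin⟩, hl, hlmax⟩ := h
  have hPne : P.Nonempty := ⟨p, hp⟩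
  have hLne : L.Nonempty := ⟨l, hl⟩
  obtain ⟨a, ha, b, hb, hab⟩ :=
    exists_isSaddlePointOn_pairing hPconv hPcomp hPne hLconv hLcomp hLne U
  intro q hq m hm
  calc pairing U (tensorPair m p)
      ≤ sSup ((fun m => pairing U (tensorPair m p)) '' L) := pairing_le_sSup hLcomp U p hm
    _ ≤ sSup ((fun m => pairing U (tensorPair m a)) '' L) := hpmin ha
    _ ≤ pairing U (tensorPair b a) := by
      refine csSup_le (hLne.image _) ?_
      rintro _ ⟨m, hm, rfl⟩
      exact hab a ha m hm
    _ ≤ sInf ((fun q => pairing U (tensorPair b q)) '' P) := by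
      refine le_csInf (hPne.image _) ?_
      rintro _ ⟨q, hq, rfl⟩
      exact hab q hq b hb
    _ ≤ sInf ((fun q => pairing U (tensorPair l q)) '' P) := hlmax hb
    _ ≤ pairing U (tensorPair l q) := sInf_le_pairing hPcomp U l hq

/-! ### The preconditioned sets -/

lemma convex_image_act {P : Set (Vec d)} (hP : Convex ℝ P) (A : Matrix (Fin d) (Fin d) ℝ) :
    Convex ℝ (act A '' P) := hP.linear_image (Matrix.toEuclideanLin A)

lemma isCompact_image_act {P : Set (Vec d)} (hP : IsCompact P) (A : Matrix (Fin d) (Fin d) ℝ) :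
    IsCompact (act A '' P) := hP.image (continuous_act A)

lemma neg_mem_preP {P : Set (Vec d)} (hP : ∀ x ∈ P, -x ∈ P) (A : Matrix (Fin d) (Fin d) ℝ) :
    ∀ x ∈ preP A P, -x ∈ preP A P := by
  rintro _ ⟨x, hx, rfl⟩
  exact ⟨-x, hP x hx, act_vec_neg A x⟩

lemma inner_act_inv_transpose (A : Matrix (Fin d) (Fin d) ℝ) (l x : Vec d) :
    (inner ℝ (act (A⁻¹).transpose l) x : ℝ) = inner ℝ l (act A⁻¹ x) :=
  (inner_act_right _ _ _).symm

/-- The preconditioned losses lie in the unit ball, since the preconditioned strategy set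
contains it. -/
lemma norm_le_one_of_mem_preL {P L : Set (Vec d)} {A : Matrix (Fin d) (Fin d) ℝ}
    (hA : IsJohnPreconditioner P A) (hbound : ∀ p ∈ P, ∀ l ∈ L, (inner ℝ p l : ℝ) ≤ 1)
    {m : Vec d} (hm : m ∈ preL A L) : ‖m‖ ≤ 1 := by
  obtain ⟨l, hl, rfl⟩ := hm
  refine norm_le_one_of_inner_le_one hA.2.1 ?_
  rintro _ ⟨p, hp, rfl⟩
  rw [inner_act_inv_transpose, act_nonsing_inv_act hA.1, real_inner_comm]
  exact hbound p hp l hl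

lemma exists_isBestResponse {P : Set (Vec d)} (hP : IsCompact P) (hne : P.Nonempty)
    (L : Set (Vec d)) : ∃ b : Vec d → Vec d, IsBestResponse P L b := by
  have h : ∀ l : Vec d, ∃ p ∈ P, IsMinOn (fun p => (inner ℝ l p : ℝ)) P p := fun l =>
    hP.exists_isMinOn hne (by fun_prop)
  choose b hb hmin using h
  exact ⟨b, fun l _ => ⟨hb l, hmin l⟩⟩

/-- Preconditioning turns best responses into best responses. -/
lemma IsBestResponse.preB {P L : Set (Vec d)} {b : Vec d → Vec d} (hb : IsBestResponse P L b)
    {A : Matrix (Fin d) (Fin d) ℝ} (hA : IsUnit A.det) :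
    IsBestResponse (preP A P) (preL A L) (preB A b) := by
  rintro _ ⟨l, hl, rfl⟩
  have h : act A.transpose (act (A⁻¹).transpose l) = l := by
    rw [← act_mul, ← Matrix.transpose_mul, Matrix.nonsing_inv_mul _ hA, Matrix.transpose_one,
      act_one]
  obtain ⟨hbP, hmin⟩ := hb l hl
  refine ⟨⟨_, by rwa [h], rfl⟩, ?_⟩
  rintro _ ⟨p, hp, rfl⟩
  simp only [LinSwap.preB, h, Set.mem_ofPred_eq, inner_act_inv_transpose, act_nonsing_inv_act hA]
  exact hmin hp

/-! ### Affine endomorphisms of a body in John's position -/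

/-- By symmetry, the linear and the constant part of an affine endomorphism map into the body. -/
lemma linear_and_const_mem_of_affineEnd {K : Set (Vec d)} (hconv : Convex ℝ K)
    (hsymm : ∀ x ∈ K, -x ∈ K) {φ : MatVec d} (hφ : φ ∈ affineEnd K) {x : Vec d} (hx : x ∈ K) :
    act φ.1 x ∈ K ∧ φ.2 ∈ K := by
  have h1 := hφ x hx
  have h2 := hφ (-x) (hsymm x hx)
  rw [act_vec_neg] at h2
  have half : (0 : ℝ) ≤ 1 / 2 := by norm_num
  constructor
  · convert hconv h1 (hsymm _ h2) half half (by norm_num) using 1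
    module
  · convert hconv h1 h2 half half (by norm_num) using 1
    module

/-- With `F` the Frobenius norm, `‖1 - M‖_F² + ‖a‖² ≤ 2 (d + d) + d`. -/
lemma pairing_one_sub_self_le {K : Set (Vec d)} (hconv : Convex ℝ K) (hcl : IsClosed K)
    (hsymm : ∀ x ∈ K, -x ∈ K) (hK : InJohnPosition K) {φ : MatVec d} (hφ : φ ∈ affineEnd K) :
    pairing ((1, 0) - φ) ((1, 0) - φ) ≤ 5 * d := by
  have h0 : (0 : Vec d) ∈ K := hK.1 (by simp)
  have hM := sum_sq_le_of_inJohnPosition hconv hcl hK (M := φ.1) fun x hx =>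
    (linear_and_const_mem_of_affineEnd hconv hsymm hφ hx).1
  have ha := norm_sq_le_of_inJohnPosition hconv hcl hsymm hK
    (linear_and_const_mem_of_affineEnd hconv hsymm hφ h0).2
  rw [← real_inner_self_eq_norm_sq, inner_eq_sum] at ha
  have h1 : pairing ((1 - φ.1, 0) : MatVec d) (1 - φ.1, 0) ≤ 4 * d := by
    have h := pairing_sub_self_le ((1, 0) : MatVec d) (φ.1, 0)
    simp only [Prod.mk_sub_mk, sub_zero] at h
    have h2 : pairing ((1, 0) : MatVec d) (1, 0) = d := by
      simp [pairing, Matrix.one_apply]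
    have h3 : pairing ((φ.1, 0) : MatVec d) (φ.1, 0) ≤ d := by simpa [pairing] using hM
    linarith
  have h4 : pairing ((1, 0) - φ) ((1, 0) - φ) =
      pairing ((1 - φ.1, 0) : MatVec d) (1 - φ.1, 0) + ∑ i, φ.2 i * φ.2 i := by
    simp [pairing]
  linarith

/-! ### Regret of the preconditioned game -/

/-- A strategy in the body and a loss in the unit ball have `‖(ℓ ⊗ p, ℓ)‖² ≤ d + 1`. -/
lemma pairing_tensorPair_self_le {l p : Vec d} (hl : ‖l‖ ≤ 1) (hp : ‖p‖ ^ 2 ≤ d) :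
    pairing (tensorPair l p) (tensorPair l p) ≤ d + 1 := by
  rw [pairing_tensorPair_self]
  have h : ‖l‖ ^ 2 ≤ 1 := pow_le_one₀ (norm_nonneg _) hl
  exact (mul_le_of_le_one_left (by positivity) h).trans (by linarith)

/-- Approachability: each increment of the state has nonpositive pairing with the current state,
because the played strategy is a saddle point, so the squared norms of the increments add up. -/
lemma pairing_algState_self_le {P L : Set (Vec d)} {A : Matrix (Fin d) (Fin d) ℝ}
    {b : Vec d → Vec d} {T : ℕ} {l p' ls : ℕ → Vec d}
    (hb : IsBestResponse (preP A P) (preL A L) (preB A b)) (hl : ∀ t < T, l t ∈ L)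
    (hp : ∀ t < T, p' t ∈ preP A P) (hls : ∀ t < T, ls t ∈ preL A L)
    (hsaddle : ∀ t < T, IsSaddlePointOn (preP A P) (preL A L)
      (fun q m => pairing (algState A b l p' ls t) (tensorPair m q)) (p' t) (ls t))
    (hP : ∀ x ∈ preP A P, ‖x‖ ^ 2 ≤ d) (hL : ∀ m ∈ preL A L, ‖m‖ ≤ 1) :
    ∀ n ≤ T, pairing (algState A b l p' ls n) (algState A b l p' ls n) ≤ 4 * (d + 1) * n := by
  intro n
  induction n with
  | zero => intro _; simp [algState, pairing]
  | succ n ih =>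
    intro hn
    have hnT : n < T := hn
    have ih := ih hnT.le
    have hbn := (hb _ (hls n hnT)).1
    have hl' : act (A⁻¹).transpose (l n) ∈ preL A L := ⟨_, hl n hnT, rfl⟩
    have h1 := hsaddle n hnT _ hbn _ hl'
    have h2 := pairing_sub_self_le (tensorPair (act (A⁻¹).transpose (l n)) (p' n))
      (tensorPair (ls n) (preB A b (ls n)))
    have h3 := pairing_tensorPair_self_le (hL _ hl') (hP _ (hp n hnT))
    have h4 := pairing_tensorPair_self_le (hL _ (hls n hnT)) (hP _ hbn)
    rw [algState, pairing_add_self, pairing_sub_right]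
    push_cast
    linarith

/-- The regret against `φ` is at most the pairing of `(1, 0) - φ` with the state: the terms
subtracted in the state contribute `⟨ℓ*, b'(ℓ*) - φ(b'(ℓ*))⟩ ≤ 0`. -/
lemma sum_inner_sub_le_pairing_algState {P L : Set (Vec d)} {A : Matrix (Fin d) (Fin d) ℝ}
    {b : Vec d → Vec d} {T : ℕ} {l p' ls : ℕ → Vec d}
    (hb : IsBestResponse (preP A P) (preL A L) (preB A b))
    (hls : ∀ t < T, ls t ∈ preL A L) {φ : MatVec d} (hφ : φ ∈ affineEnd (preP A P)) :
    ∀ n ≤ T, ∑ t ∈ Finset.range n,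
      (inner ℝ (act (A⁻¹).transpose (l t)) (p' t - (act φ.1 (p' t) + φ.2)) : ℝ) ≤
        pairing ((1, 0) - φ) (algState A b l p' ls n) := by
  have hW : ∀ m q : Vec d, pairing ((1, 0) - φ) (tensorPair m q) =
      inner ℝ m (q - (act φ.1 q + φ.2)) := fun m q => by
    rw [pairing_tensorPair, Prod.fst_sub, Prod.snd_sub, act_sub, act_one]
    congr 1
    simp only [zero_sub]
    abel
  intro n
  induction n with
  | zero => intro _; simp [algState, pairing]
  | succ n ih =>
    intro hn
    have hnT : n < T := hn
    have ih := ih hnT.le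
    obtain ⟨hbn, hmin⟩ := hb _ (hls n hnT)
    have h : (inner ℝ (ls n) (preB A b (ls n)) : ℝ) ≤
        inner ℝ (ls n) (act φ.1 (preB A b (ls n)) + φ.2) := hmin (hφ _ hbn)
    rw [Finset.sum_range_succ, algState, pairing_add_right, pairing_sub_right, hW, hW,
      inner_sub_right (ls n)]
    linarith

/-- Conjugation by `A` carries the affine endomorphisms of `P` to those of `A P`. -/
lemma conj_mem_affineEnd_preP {P : Set (Vec d)} {A : Matrix (Fin d) (Fin d) ℝ}
    (hA : IsUnit A.det) {φ : MatVec d} (hφ : φ ∈ affineEnd P) :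
    ((A * φ.1 * A⁻¹, act A φ.2) : MatVec d) ∈ affineEnd (preP A P) := by
  rintro _ ⟨p, hp, rfl⟩
  refine ⟨_, hφ p hp, ?_⟩
  rw [act_mul, act_mul, act_nonsing_inv_act hA, act_vec_add]

theorem linearSwapReg_le_of_isRun {P L : Set (Vec d)}
    (hPconv : Convex ℝ P) (hPcomp : IsCompact P) (hPsymm : ∀ x ∈ P, -x ∈ P)
    (hLconv : Convex ℝ L) (hLcomp : IsCompact L)
    (hbound : ∀ p ∈ P, ∀ l ∈ L, (inner ℝ p l : ℝ) ≤ 1)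
    {b : Vec d → Vec d} (hb : IsBestResponse P L b) {A : Matrix (Fin d) (Fin d) ℝ} {T : ℕ}
    {l p' ls p : ℕ → Vec d} (hl : ∀ t < T, l t ∈ L) (hrun : IsRun P L b A T l p' ls p) :
    linearSwapReg P T l p ≤ 8 * (d : ℝ) * Real.sqrt (T : ℝ) := by
  obtain ⟨⟨hA, hJ⟩, hmm, hplay⟩ := hrun
  have hconv : Convex ℝ (preP A P) := convex_image_act hPconv A
  have hcomp : IsCompact (preP A P) := isCompact_image_act hPcomp A
  have hsymm := neg_mem_preP hPsymm A
  have hb' := hb.preB hA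
  have hU := pairing_algState_self_le hb' hl (fun t ht => (hmm t ht).1.1)
    (fun t ht => (hmm t ht).2.1)
    (fun t ht => (hmm t ht).isSaddlePointOn hconv hcomp (convex_image_act hLconv _)
      (isCompact_image_act hLcomp _))
    (fun x hx => norm_sq_le_of_inJohnPosition hconv hcomp.isClosed hsymm hJ hx)
    (fun m hm => norm_le_one_of_mem_preL ⟨hA, hJ⟩ hbound hm) T le_rfl
  suffices h : ∀ φ ∈ affineEnd P, ∑ t ∈ Finset.range T, (inner ℝ (l t) (p t) : ℝ) -
      8 * (d : ℝ) * Real.sqrt (T : ℝ) ≤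
        ∑ t ∈ Finset.range T, inner ℝ (l t) (act φ.1 (p t) + φ.2) by
    have hid : ((1, 0) : MatVec d) ∈ affineEnd P := fun q hq => by simpa [act_one] using hq
    have h' := le_csInf (Set.Nonempty.image (fun φ : MatVec d =>
      ∑ t ∈ Finset.range T, (inner ℝ (l t) (act φ.1 (p t) + φ.2) : ℝ)) ⟨_, hid⟩)
      (Set.forall_mem_image.mpr h)
    rw [linearSwapReg]
    linarith
  intro φ hφ
  have hφ' := conj_mem_affineEnd_preP hA hφ
  have hreg := sum_inner_sub_le_pairing_algState (l := l) (p' := p') hb'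
    (fun t ht => (hmm t ht).2.1) hφ' T le_rfl
  have hW := pairing_one_sub_self_le hconv hcomp.isClosed hsymm hJ hφ'
  have hsum : ∑ t ∈ Finset.range T, (inner ℝ (act (A⁻¹).transpose (l t))
      (p' t - (act (A * φ.1 * A⁻¹) (p' t) + act A φ.2)) : ℝ) =
      ∑ t ∈ Finset.range T, (inner ℝ (l t) (p t) : ℝ) -
        ∑ t ∈ Finset.range T, inner ℝ (l t) (act φ.1 (p t) + φ.2) := by
    rw [← Finset.sum_sub_distrib]
    refine Finset.sum_congr rfl fun t ht => ?_
    rw [hplay t (Finset.mem_range.mp ht), inner_sub_right, inner_act_inv_transpose,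
      inner_act_inv_transpose, act_mul, act_mul, ← act_vec_add, act_nonsing_inv_act hA]
  rw [hsum] at hreg
  set U := algState A b l p' ls T
  -- `5 d · 4 (d + 1) ≤ 40 d² ≤ 64 d²`; the case `d = 0`, where `d + 1 ≤ 2 d` fails, is trivial.
  have hsq : pairing ((1, 0) - (A * φ.1 * A⁻¹, act A φ.2)) U ^ 2 ≤
      (8 * (d : ℝ) * Real.sqrt (T : ℝ)) ^ 2 := by
    have hd : (d : ℝ) ≤ (d : ℝ) ^ 2 := by exact_mod_cast Nat.le_self_pow two_ne_zero d
    calc _ ≤ _ := sq_pairing_le _ _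
      _ ≤ (5 * d) * (4 * (d + 1) * T) :=
        mul_le_mul hW hU (pairing_self_nonneg _) (by positivity)
      _ ≤ 64 * (d : ℝ) ^ 2 * T := by
        rw [← mul_assoc]
        exact mul_le_mul_of_nonneg_right (by nlinarith) (Nat.cast_nonneg T)
      _ = _ := by rw [mul_pow, mul_pow, Real.sq_sqrt (Nat.cast_nonneg T)]; ring
  have := abs_le_of_sq_le_sq' hsq (by positivity)
  linarith [this.2]

end LinSwap

theorem mainTheorem1 (d : ℕ) (P L : Set (LinSwap.Vec d))
    (hPconv : Convex ℝ P) (hPcomp : IsCompact P) (hPint : (interior P).Nonempty)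
    (hPsymm : ∀ x ∈ P, -x ∈ P)
    (hLconv : Convex ℝ L) (hLcomp : IsCompact L) (hLne : L.Nonempty)
    (hbound : ∀ p ∈ P, ∀ l ∈ L, (inner ℝ p l : ℝ) ≤ 1) :
    -- every step of the algorithm can be carried out
    ((∃ b : LinSwap.Vec d → LinSwap.Vec d, LinSwap.IsBestResponse P L b) ∧
      (∃ A : Matrix (Fin d) (Fin d) ℝ, LinSwap.IsJohnPreconditioner P A) ∧
      (∀ A : Matrix (Fin d) (Fin d) ℝ, LinSwap.IsJohnPreconditioner P A →
        ∀ U : LinSwap.MatVec d, ∃ p' ls : LinSwap.Vec d,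
          LinSwap.IsMinimaxPair (LinSwap.preP A P) (LinSwap.preL A L) U p' ls)) ∧
    -- every execution plays in `P` and satisfies the regret bound
    (∀ (b : LinSwap.Vec d → LinSwap.Vec d), LinSwap.IsBestResponse P L b →
      ∀ (A : Matrix (Fin d) (Fin d) ℝ) (T : ℕ) (l p' ls p : ℕ → LinSwap.Vec d),
        (∀ t < T, l t ∈ L) → LinSwap.IsRun P L b A T l p' ls p →
          (∀ t < T, p t ∈ P) ∧
          LinSwap.linearSwapReg P T l p ≤ 8 * (d : ℝ) * Real.sqrt (T : ℝ)) := by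
  have hPne : P.Nonempty := hPint.mono interior_subset
  refine ⟨⟨LinSwap.exists_isBestResponse hPcomp hPne L,
    LinSwap.exists_isJohnPreconditioner hPconv hPcomp hPint hPsymm, fun A _ U =>
      LinSwap.exists_isMinimaxPair (LinSwap.convex_image_act hPconv A)
        (LinSwap.isCompact_image_act hPcomp A) (hPne.image _)
        (LinSwap.convex_image_act hLconv _) (LinSwap.isCompact_image_act hLcomp _)
        (hLne.image _) U⟩, ?_⟩
  intro b hb A T l p' ls p hl hrun
  refine ⟨fun t ht => ?_, LinSwap.linearSwapReg_le_of_isRun hPconv hPcomp hPsymm hLconv hLcomp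
    hbound hb hl hrun⟩
  obtain ⟨x, hx, hxp⟩ := (hrun.minimax t ht).1.1
  rwa [hrun.play t ht, ← hxp, LinSwap.act_nonsing_inv_act hrun.precondition.1]
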